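/- Let $n \ge 1$. A proper cone in a finite-dimensional real vector space $V$ is a closed set $K \subseteq V$ with $x+y \in K$ and $\alpha x \in K$ for all $x, y \in K$, $\alpha \ge 0$, such that $K \cap (-K) = \{0\}$ and $\operatorname{int}(K) \neq \emptyset$. A totally positive structure on $\mathbb{R}^n$ is a family $\{K_1, \ldots, K_n\}$ of proper cones $K_j \subset \wedge^j \mathbb{R}^n$ (with $\wedge^1 \mathbb{R}^n = \mathbb{R}^n$). A linear operator $A : \mathbb{R}^n \to \mathbb{R}^n$ is called generalized strictly totally positive (GSTP) with respect to it if $(\wedge^j A)(K_j \setminus \{0\}) \subseteq \operatorname{int}(K_j)$ for every $j = 1, \ldots, n$, where $\wedge^j A$ is the $j$-th exterior power of $A$. Let $\{K_1, \ldots, K_n\}$ be a totally positive structure on $\mathbb{R}^n$ for which at least one GSTP operator exists. Then for every $j = 2, \ldots, n$ the set $\operatorname{int}(K_j)$ contains a nonzero simple $j$-vector, i.e. there are $x_1, \ldots, x_j \in \mathbb{R}^n$ with $0 \neq x_1 \wedge \cdots \wedge x_j \in \operatorname{int}(K_j)$. -/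

import Mathlib

namespace GenTotPos

/-- The Euclidean space `ℝⁿ`. -/
abbrev Rn (n : ℕ) : Type := EuclideanSpace ℝ (Fin n)

/-- The `j`-th exterior power `⋀ʲ ℝⁿ`. -/
abbrev Ext (n j : ℕ) : Type := ⋀[ℝ]^j (Rn n)

/-- The basis `e_{i₁} ∧ … ∧ e_{i_j}`, `i₁ < … < i_j`, of `⋀ʲ ℝⁿ` that comes from the standard
basis of `ℝⁿ`. -/
noncomputable def stdBasis (n j : ℕ) : Module.Basis (Set.powersetCard (Fin n) j) ℝ (Ext n j) :=
  (EuclideanSpace.basisFun (Fin n) ℝ).toBasis.exteriorPower j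

/-- The usual topology of the finite-dimensional real vector space `⋀ʲ ℝⁿ`: the one of
`ℝ^(n choose j)`, through the coordinates in the standard basis. -/
noncomputable instance instTopologicalSpaceExt (n j : ℕ) : TopologicalSpace (Ext n j) :=
  TopologicalSpace.induced (stdBasis n j).equivFun inferInstance

instance instIsTopologicalAddGroupExt (n j : ℕ) : IsTopologicalAddGroup (Ext n j) :=
  topologicalAddGroup_induced (stdBasis n j).equivFun

instance instContinuousSMulExt (n j : ℕ) : ContinuousSMul ℝ (Ext n j) :=
  continuousSMul_induced (stdBasis n j).equivFun

instance instT2SpaceExt (n j : ℕ) : T2Space (Ext n j) :=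
  T2Space.of_injective_continuous (stdBasis n j).equivFun.injective continuous_induced_dom

/-- A proper cone: a closed convex cone which is pointed and solid. -/
structure IsProperCone {V : Type*} [AddCommGroup V] [Module ℝ V] [TopologicalSpace V]
    (K : Set V) : Prop where
  isClosed : IsClosed K
  add_mem : ∀ x ∈ K, ∀ y ∈ K, x + y ∈ K
  smul_mem : ∀ x ∈ K, ∀ α : ℝ, 0 ≤ α → α • x ∈ K
  pointed : K ∩ {x | -x ∈ K} = {0}
  solid : (interior K).Nonempty

/-- A linear operator `A` is `K`-positive if `A (K \ {0}) ⊆ int K`. -/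
def IsConePositive {V : Type*} [AddCommGroup V] [Module ℝ V] [TopologicalSpace V]
    (K : Set V) (A : V →ₗ[ℝ] V) : Prop :=
  Set.MapsTo A (K \ {0}) (interior K)

/-- A totally positive structure on `ℝⁿ`: proper cones `K₁, …, Kₙ` with `K_j ⊆ ⋀ʲ ℝⁿ`
(where `⋀¹ ℝⁿ = ℝⁿ`). The values of `cone` outside `1, …, n` play no role. -/
structure TotallyPositiveStructure (n : ℕ) where
  cone : ∀ j : ℕ, Set (Ext n j)
  isProperCone : ∀ j : ℕ, 1 ≤ j → j ≤ n → IsProperCone (cone j)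

/-- `A` is generalized strictly totally positive with respect to `S = {K₁, …, Kₙ}`:
for `j = 1, …, n` its `j`-th exterior power is `K_j`-positive. -/
def IsGSTP {n : ℕ} (S : TotallyPositiveStructure n) (A : Rn n →ₗ[ℝ] Rn n) : Prop :=
  ∀ j : ℕ, 1 ≤ j → j ≤ n → IsConePositive (S.cone j) (exteriorPower.map j A)

/-- A totally positive structure is strictly totally positive if it admits a GSTP operator. -/
def TotallyPositiveStructure.IsStrict {n : ℕ} (S : TotallyPositiveStructure n) : Prop :=
  ∃ A : Rn n →ₗ[ℝ] Rn n, IsGSTP S A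

/-- The Grassmann cone: the set of all simple (decomposable) `j`-vectors `x₁ ∧ … ∧ x_j`. -/
def grassmannCone (n j : ℕ) : Set (Ext n j) :=
  Set.range fun x : Fin j → Rn n => exteriorPower.ιMulti ℝ j x

end GenTotPos

/-! Put `B = ⋀ʲ A` and fix `u` in the interior of `K`. Positivity makes `B` a Birkhoff-type
contraction: every `x` satisfies `m Bᵏu ≤ Bᵏx ≤ M Bᵏu` in the cone order, with `M - m → 0`
(`exists_contraction`, `exists_tight_order_bounds`). If no `±Bᵏx` is interior, then `m ≤ 0 ≤ M`, so
`x` is `negligible` relative to `u`. Negligible vectors form a subspace that omits `u`, so they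
cannot include a spanning set. Simple `j`-vectors span and are preserved by `B` and by sign change,
hence some `±Bᵏx` with `x` simple is interior. -/

open Topology

namespace GenTotPos

/-! ### The cone order and negligible vectors -/

namespace IsProperCone

variable {V : Type*} [AddCommGroup V] [Module ℝ V] [TopologicalSpace V] {K : Set V}

theorem zero_mem (hK : IsProperCone K) : (0 : V) ∈ K := by
  have h : (0 : V) ∈ K ∩ {x | -x ∈ K} := by rw [hK.pointed]; rfl
  exact h.1

theorem eq_zero_of_neg_mem (hK : IsProperCone K) {x : V} (hx : x ∈ K) (hx' : -x ∈ K) : x = 0 := by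
  have h : x ∈ K ∩ {x | -x ∈ K} := ⟨hx, hx'⟩
  rwa [hK.pointed] at h

/-- Pointedness, in the form that turns cone memberships into inequalities between real
coefficients. -/
theorem nonneg_of_smul_mem (hK : IsProperCone K) {u : V} (hu : u ∈ K) (hu0 : u ≠ 0) {a : ℝ}
    (h : a • u ∈ K) : 0 ≤ a := by
  by_contra! ha
  refine hu0 (hK.eq_zero_of_neg_mem hu ?_)
  have := hK.smul_mem _ h (-a)⁻¹ (by simpa using ha.le)
  rw [smul_smul, inv_neg, neg_mul, inv_mul_cancel₀ ha.ne, neg_one_smul] at this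
  exact this

/-- If `z` dominates `δ • u` and `u` dominates `δ • z`, then the same holds for smaller `δ`. -/
theorem comparable_anti (hK : IsProperCone K) {u z : V} (hu : u ∈ K) {δ δ' : ℝ} (hδ' : 0 < δ')
    (h : δ' ≤ δ) (hz : z - δ • u ∈ K ∧ u - δ • z ∈ K) : z - δ' • u ∈ K ∧ u - δ' • z ∈ K := by
  have hδ : 0 < δ := hδ'.trans_le h
  constructor
  · have := hK.add_mem _ hz.1 _ (hK.smul_mem _ hu (δ - δ') (by linarith))
    convert this using 1
    module
  · have := hK.add_mem _ (hK.smul_mem _ hu (1 - δ' / δ) (by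
      rw [sub_nonneg, div_le_one hδ]; exact h))
      _ (hK.smul_mem _ hz.2 (δ' / δ) (by positivity))
    convert this using 1
    match_scalars
    · field_simp
      ring
    · field_simp

theorem map_mem (hK : IsProperCone K) {B : V →ₗ[ℝ] V} (hB : IsConePositive K B) {x : V}
    (hx : x ∈ K) :
    B x ∈ K := by
  rcases eq_or_ne x 0 with rfl | h
  · simpa using hK.zero_mem
  · exact interior_subset (hB ⟨hx, h⟩)

theorem order_bound_mono (hK : IsProperCone K) {B : V →ₗ[ℝ] V} (hB : IsConePositive K B)
    {u x : V} {a : ℝ} {k l : ℕ} (hkl : k ≤ l) (h : a • (B ^ k) u - (B ^ k) x ∈ K) :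
    a • (B ^ l) u - (B ^ l) x ∈ K := by
  induction l, hkl using Nat.le_induction with
  | base => exact h
  | succ l _ ih =>
    have := hK.map_mem hB ih
    simpa only [map_sub, map_smul, pow_succ', Module.End.mul_apply] using this

/-- The vectors whose iterates under `B` are negligible compared with those of `u ∈ K`. -/
def negligible (hK : IsProperCone K) {B : V →ₗ[ℝ] V} (hB : IsConePositive K B) {u : V}
    (hu : u ∈ K) : Submodule ℝ V where
  carrier := {x | ∀ ε : ℝ, 0 < ε → ∃ k : ℕ, ε • (B ^ k) u - (B ^ k) x ∈ K ∧
    ε • (B ^ k) u - (B ^ k) (-x) ∈ K}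
  zero_mem' := by
    intro ε hε
    exact ⟨0, by simpa using hK.smul_mem _ hu ε hε.le, by simpa using hK.smul_mem _ hu ε hε.le⟩
  add_mem' := by
    intro x y hx hy ε hε
    obtain ⟨k, hk, hk'⟩ := hx (ε / 2) (by positivity)
    obtain ⟨l, hl, hl'⟩ := hy (ε / 2) (by positivity)
    -- Bounds persist under further iteration, so both hold at the later index.
    refine ⟨max k l, ?_, ?_⟩
    · convert hK.add_mem _ (hK.order_bound_mono hB (le_max_left k l) hk) _
        (hK.order_bound_mono hB (le_max_right k l) hl) using 1
      rw [map_add]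
      module
    · convert hK.add_mem _ (hK.order_bound_mono hB (le_max_left k l) hk') _
        (hK.order_bound_mono hB (le_max_right k l) hl') using 1
      simp only [map_neg, map_add]
      module
  smul_mem' := by
    have key : ∀ (a : ℝ) (x : V), 0 ≤ a →
        (∀ ε : ℝ, 0 < ε → ∃ k : ℕ, ε • (B ^ k) u - (B ^ k) x ∈ K ∧
          ε • (B ^ k) u - (B ^ k) (-x) ∈ K) →
        ∀ ε : ℝ, 0 < ε → ∃ k : ℕ, ε • (B ^ k) u - (B ^ k) (a • x) ∈ K ∧
          ε • (B ^ k) u - (B ^ k) (-(a • x)) ∈ K := by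
      intro a x ha hx ε hε
      -- The `+ 1` allows `a = 0`; the spare `ε / (a + 1)` is filled by a multiple of `(B ^ k) u`.
      obtain ⟨k, hk, hk'⟩ := hx (ε / (a + 1)) (by positivity)
      have hu' : (B ^ k) u ∈ K := by
        have := hK.order_bound_mono hB (u := u) (x := 0) (a := 1) (Nat.zero_le k)
          (by simpa using hu)
        simpa using this
      have hu'' := hK.smul_mem _ hu' (ε / (a + 1)) (by positivity)
      refine ⟨k, ?_, ?_⟩
      · convert hK.add_mem _ (hK.smul_mem _ hk a ha) _ hu'' using 1
        rw [map_smul]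
        match_scalars <;> field_simp
      · convert hK.add_mem _ (hK.smul_mem _ hk' a ha) _ hu'' using 1
        simp only [map_neg, map_smul]
        match_scalars <;> field_simp
    intro a x hx
    rcases le_total 0 a with ha | ha
    · exact key a x ha hx
    · have := key (-a) (-x) (by linarith) fun ε hε => by
        obtain ⟨k, h, h'⟩ := hx ε hε
        exact ⟨k, h', by rwa [neg_neg]⟩
      rw [smul_neg, neg_smul, neg_neg] at this
      exact this

/-! ### Interior points and compactness -/

variable [IsTopologicalAddGroup V] [ContinuousSMul ℝ V]

theorem zero_notMem_interior [Nontrivial V] (hK : IsProperCone K) : (0 : V) ∉ interior K := by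
  intro h
  obtain ⟨x, hx⟩ := exists_ne (0 : V)
  have hc : Filter.Tendsto (fun t : ℝ => t • x) (𝓝 0) (𝓝 0) := by
    have : Continuous fun t : ℝ => t • x := by fun_prop
    simpa using this.tendsto 0
  have hc' : Filter.Tendsto (fun t : ℝ => -(t • x)) (𝓝 0) (𝓝 0) := by simpa using hc.neg
  have hn := mem_interior_iff_mem_nhds.1 h
  have h1 := ((hc.eventually hn).and (hc'.eventually hn)).filter_mono
    (nhdsWithin_le_nhds (s := Set.Ioi (0 : ℝ)))
  obtain ⟨t, ⟨ht, ht'⟩, ht0⟩ := (h1.and self_mem_nhdsWithin).exists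
  exact smul_ne_zero (ne_of_gt ht0) hx (hK.eq_zero_of_neg_mem ht ht')

theorem smul_add_mem_interior (hK : IsProperCone K) {u x : V} (hu : u ∈ interior K) (hx : x ∈ K)
    {t : ℝ} (ht : 0 < t) : t • u + x ∈ interior K := by
  have ho : IsOpen ((fun z => t⁻¹ • (z - x)) ⁻¹' interior K) :=
    isOpen_interior.preimage (by fun_prop)
  refine interior_maximal ?_ ho ?_
  · intro z hz
    have h := hK.add_mem _ (hK.smul_mem _ (interior_subset hz) t ht.le) _ hx
    rwa [smul_smul, mul_inv_cancel₀ ht.ne', one_smul, sub_add_cancel] at h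
  · simpa [smul_smul, inv_mul_cancel₀ ht.ne'] using hu

/-- Elements of a compact subset of the interior are uniformly comparable with `u`. -/
theorem exists_forall_comparable (hK : IsProperCone K) {u : V} (hu : u ∈ interior K) {C : Set V}
    (hC : IsCompact C) (hCK : C ⊆ interior K) :
    ∃ δ : ℝ, 0 < δ ∧ δ < 1 ∧ ∀ z ∈ C, z - δ • u ∈ K ∧ u - δ • z ∈ K := by
  refine hC.induction_on (p := fun s => ∃ δ : ℝ, 0 < δ ∧ δ < 1 ∧
    ∀ z ∈ s, z - δ • u ∈ K ∧ u - δ • z ∈ K) ⟨1 / 2, by norm_num, by norm_num, by simp⟩ ?_ ?_ ?_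
  · rintro s t hst ⟨δ, h0, h1, h⟩
    exact ⟨δ, h0, h1, fun z hz => h z (hst hz)⟩
  · rintro s t ⟨δ, h0, h1, h⟩ ⟨δ', h0', h1', h'⟩
    refine ⟨min δ δ', lt_min h0 h0', (min_le_left _ _).trans_lt h1, ?_⟩
    rintro z (hz | hz)
    · exact hK.comparable_anti (interior_subset hu) (lt_min h0 h0') (min_le_left _ _) (h z hz)
    · exact hK.comparable_anti (interior_subset hu) (lt_min h0 h0') (min_le_right _ _) (h' z hz)
  · intro z hz
    have hf : Continuous fun p : ℝ × V => p.2 - p.1 • u := by fun_prop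
    have hg : Continuous fun p : ℝ × V => u - p.1 • p.2 := by fun_prop
    have hf' : ∀ᶠ p in 𝓝 ((0 : ℝ), z), p.2 - p.1 • u ∈ interior K :=
      hf.continuousAt.eventually_mem (isOpen_interior.mem_nhds (by simpa using hCK hz))
    have hg' : ∀ᶠ p in 𝓝 ((0 : ℝ), z), u - p.1 • p.2 ∈ interior K :=
      hg.continuousAt.eventually_mem (isOpen_interior.mem_nhds (by simpa using hu))
    have h := hf'.and hg'
    rw [nhds_prod_eq] at h
    obtain ⟨pa, ha, pb, hb, hab⟩ := Filter.eventually_prod_iff.1 h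
    have ha' := (ha.and (gt_mem_nhds one_pos)).filter_mono
      (nhdsWithin_le_nhds (s := Set.Ioi (0 : ℝ)))
    obtain ⟨δ, ⟨hδ, hδ1⟩, hδ0⟩ := (ha'.and self_mem_nhdsWithin).exists
    exact ⟨{y | pb y}, mem_nhdsWithin_of_mem_nhds hb, δ, hδ0, hδ1,
      fun y hy => ⟨interior_subset (hab hδ hy).1, interior_subset (hab hδ hy).2⟩⟩

/-- A `K`-positive operator maps `K` to vectors that are uniformly proportional to `u`. -/
theorem exists_uniform_comparison [T2Space V] [FiniteDimensional ℝ V] (hK : IsProperCone K)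
    {u : V} (hu : u ∈ interior K) {B : V →ₗ[ℝ] V} (hB : IsConePositive K B) :
    ∃ η : ℝ, 0 < η ∧ η < 1 ∧
      ∀ y ∈ K, ∃ β : ℝ, 0 ≤ β ∧ B y - β • u ∈ K ∧ β • u - η • B y ∈ K := by
  let e : V ≃L[ℝ] EuclideanSpace ℝ (Fin (Module.finrank ℝ V)) :=
    ContinuousLinearEquiv.ofFinrankEq (by simp)
  -- A compact base of the cone; `B` maps it into the interior.
  have hC : IsCompact (K ∩ e ⁻¹' Metric.sphere 0 1) := by
    have : IsCompact (e ⁻¹' Metric.sphere 0 1) :=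
      e.toHomeomorph.isCompact_preimage.2 (isCompact_sphere _ _)
    exact this.inter_left hK.isClosed
  have hBc : Continuous B := B.continuous_of_finiteDimensional
  obtain ⟨δ, h0, h1, h⟩ := hK.exists_forall_comparable hu (hC.image hBc) (by
    rintro _ ⟨c, ⟨hc, hc1⟩, rfl⟩
    refine hB ⟨hc, ?_⟩
    rintro rfl
    simp at hc1)
  -- One `δ` is absorbed in `β = ‖e y‖ * δ`, the other comes from the upper comparison.
  refine ⟨δ * δ, by positivity, by nlinarith, fun y hy => ?_⟩
  rcases eq_or_ne y 0 with rfl | hy0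
  · exact ⟨0, le_rfl, by simpa using hK.zero_mem, by simpa using hK.zero_mem⟩
  have ht : 0 < ‖e y‖ := norm_pos_iff.2 (by simpa using hy0)
  set t := ‖e y‖
  obtain ⟨h2, h3⟩ := h (B (t⁻¹ • y)) ⟨_, ⟨hK.smul_mem _ hy _ (by positivity), by
    simp [norm_smul, t, ht.ne']⟩, rfl⟩
  refine ⟨t * δ, by positivity, ?_, ?_⟩
  · have := hK.smul_mem _ h2 t ht.le
    convert this using 1
    rw [map_smul]
    match_scalars <;> field_simp
  · have := hK.smul_mem _ h3 (t * δ) (by positivity)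
    convert this using 1
    rw [map_smul]
    match_scalars <;> field_simp

theorem exists_order_bounds (hK : IsProperCone K) {u : V} (hu : u ∈ interior K) (x : V) :
    ∃ m M : ℝ, x - m • u ∈ K ∧ M • u - x ∈ K := by
  have key : ∀ y : V, ∃ M : ℝ, M • u - y ∈ K := by
    intro y
    have hc : Continuous fun t : ℝ => u - t • y := by fun_prop
    have h := (hc.continuousAt (x := 0)).eventually_mem
      (isOpen_interior.mem_nhds (s := interior K) (by simpa using hu))
    obtain ⟨t, ht, ht0⟩ := ((h.filter_mono
      (nhdsWithin_le_nhds (s := Set.Ioi (0 : ℝ)))).and self_mem_nhdsWithin).exists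
    have ht0 : 0 < t := ht0
    refine ⟨t⁻¹, ?_⟩
    convert hK.smul_mem _ (interior_subset ht) t⁻¹ (by positivity) using 1
    match_scalars <;> field_simp
  obtain ⟨M, hM⟩ := key x
  obtain ⟨m, hm⟩ := key (-x)
  refine ⟨-m, M, ?_, hM⟩
  convert hm using 1
  module

/-! ### Contraction along iterates -/

section Iterates

variable [Nontrivial V] {B : V →ₗ[ℝ] V} {u : V}

theorem ne_zero_of_mem_interior (hK : IsProperCone K) (hu : u ∈ interior K) : u ≠ 0 := by
  rintro rfl
  exact hK.zero_notMem_interior hu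

theorem pow_mem_interior (hK : IsProperCone K) (hB : IsConePositive K B) (hu : u ∈ interior K)
    (k : ℕ) : (B ^ k) u ∈ interior K := by
  induction k with
  | zero => simpa using hu
  | succ k ih =>
    rw [pow_succ', Module.End.mul_apply]
    exact hB ⟨interior_subset ih, hK.ne_zero_of_mem_interior ih⟩

variable [T2Space V] [FiniteDimensional ℝ V]

/-- One application of `B` shrinks the gap between order bounds by a uniform factor. -/
theorem exists_contraction (hK : IsProperCone K) (hB : IsConePositive K B) (hu : u ∈ interior K) :
    ∃ θ : ℝ, 0 ≤ θ ∧ θ < 1 ∧ ∀ v ∈ interior K, ∀ (x : V) (m M : ℝ), x - m • v ∈ K →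
      M • v - x ∈ K → ∃ m' M' : ℝ, B x - m' • B v ∈ K ∧ M' • B v - B x ∈ K ∧
        M' - m' ≤ θ * (M - m) := by
  obtain ⟨η, h0, h1, h⟩ := hK.exists_uniform_comparison hu hB
  have huK := interior_subset hu
  have hu0 := hK.ne_zero_of_mem_interior hu
  -- The gaps `B (x - m • v)` and `B (M • v - x)` dominate `β₁ • u` and `β₂ • u`, and `u` dominates
  -- `(η / γ) • B v`, so the bounds tighten by `(β₁ + β₂) * η / γ` in total. By `hsum` this is at
  -- least `η² (M - m)`.
  refine ⟨1 - η * η, by nlinarith, by nlinarith, fun v hv x m M hm hM => ?_⟩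
  obtain ⟨γ, hγ, hγ1, hγ2⟩ := h v (interior_subset hv)
  obtain ⟨β₁, hβ₁, hl₁, hr₁⟩ := h _ hm
  obtain ⟨β₂, hβ₂, hl₂, hr₂⟩ := h _ hM
  rw [map_sub, map_smul] at hl₁ hr₁ hl₂ hr₂
  have hvi : B v ∈ interior K := hB ⟨interior_subset hv, hK.ne_zero_of_mem_interior hv⟩
  have hγ0 : 0 < γ := by
    refine hγ.lt_of_ne ?_
    rintro rfl
    have := hK.nonneg_of_smul_mem (interior_subset hvi) (hK.ne_zero_of_mem_interior hvi)
      (a := -η) (by simpa using hγ2)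
    linarith
  have hw : 0 ≤ M - m := by
    refine hK.nonneg_of_smul_mem (interior_subset hv) (hK.ne_zero_of_mem_interior hv) ?_
    convert hK.add_mem _ hm _ hM using 1
    module
  have hsum : 0 ≤ β₁ + β₂ - η * (M - m) * γ := by
    refine hK.nonneg_of_smul_mem huK hu0 ?_
    convert hK.add_mem _ (hK.add_mem _ hr₁ _ hr₂) _
      (hK.smul_mem _ hγ1 (η * (M - m)) (by positivity)) using 1
    module
  refine ⟨m + β₁ * η / γ, M - β₂ * η / γ, ?_, ?_, ?_⟩
  · convert hK.add_mem _ hl₁ _ (hK.smul_mem _ hγ2 (β₁ / γ) (by positivity)) using 1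
    match_scalars <;> field_simp <;> ring
  · convert hK.add_mem _ hl₂ _ (hK.smul_mem _ hγ2 (β₂ / γ) (by positivity)) using 1
    match_scalars <;> field_simp <;> ring
  · have : η * (M - m) ≤ (β₁ + β₂) / γ := by rw [le_div_iff₀ hγ0]; linarith
    have h5 := mul_le_mul_of_nonneg_right this h0.le
    have h6 : (β₁ + β₂) / γ * η = β₁ * η / γ + β₂ * η / γ := by ring
    nlinarith

/-- The order bounds of the iterates `B ^ k x` in terms of `B ^ k u` become arbitrarily tight. -/
theorem exists_tight_order_bounds (hK : IsProperCone K) (hB : IsConePositive K B)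
    (hu : u ∈ interior K) (x : V) {ε : ℝ} (hε : 0 < ε) :
    ∃ (k : ℕ) (m M : ℝ), (B ^ k) x - m • (B ^ k) u ∈ K ∧ M • (B ^ k) u - (B ^ k) x ∈ K ∧
      M - m < ε := by
  obtain ⟨θ, h0, h1, h⟩ := hK.exists_contraction hB hu
  obtain ⟨m₀, M₀, hm₀, hM₀⟩ := hK.exists_order_bounds hu x
  have key : ∀ k : ℕ, ∃ m M : ℝ, (B ^ k) x - m • (B ^ k) u ∈ K ∧
      M • (B ^ k) u - (B ^ k) x ∈ K ∧ M - m ≤ θ ^ k * (M₀ - m₀) := by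
    intro k
    induction k with
    | zero => exact ⟨m₀, M₀, by simpa using hm₀, by simpa using hM₀, by simp⟩
    | succ k ih =>
      obtain ⟨m, M, hm, hM, hw⟩ := ih
      obtain ⟨m', M', hm', hM', hw'⟩ := h _ (hK.pow_mem_interior hB hu k) _ m M hm hM
      refine ⟨m', M', ?_, ?_, ?_⟩
      · simpa only [pow_succ', Module.End.mul_apply] using hm'
      · simpa only [pow_succ', Module.End.mul_apply] using hM'
      · rw [pow_succ', mul_assoc]
        exact hw'.trans (mul_le_mul_of_nonneg_left hw h0)
  have hlim : Filter.Tendsto (fun k : ℕ => θ ^ k * (M₀ - m₀)) Filter.atTop (𝓝 0) := by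
    simpa using (tendsto_pow_atTop_nhds_zero_of_lt_one h0 h1).mul_const (M₀ - m₀)
  obtain ⟨k, hk⟩ := (hlim.eventually (gt_mem_nhds hε)).exists
  obtain ⟨m, M, hm, hM, hw⟩ := key k
  exact ⟨k, m, M, hm, hM, hw.trans_lt hk⟩

/-- Some vector of a spanning set is moved into the interior of `K`, up to sign, by an iterate of
a `K`-positive operator. -/
theorem exists_pow_mem_interior_of_span_eq_top (hK : IsProperCone K) (hB : IsConePositive K B)
    {s : Set V} (hs : Submodule.span ℝ s = ⊤) :
    ∃ x ∈ s, ∃ k : ℕ, (B ^ k) x ∈ interior K ∨ -(B ^ k) x ∈ interior K := by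
  by_contra! hcon
  obtain ⟨u, hu⟩ := hK.solid
  have huK : ∀ k, (B ^ k) u ∈ K := fun k => interior_subset (hK.pow_mem_interior hB hu k)
  have hle : s ⊆ hK.negligible hB (interior_subset hu) := by
    intro x hx ε hε
    obtain ⟨k, m, M, hm, hM, hw⟩ := hK.exists_tight_order_bounds hB hu x hε
    have hi := hK.pow_mem_interior hB hu k
    have hm0 : m ≤ 0 := by
      by_contra! h
      apply (hcon x hx k).1
      simpa using hK.smul_add_mem_interior hi hm h
    have hM0 : 0 ≤ M := by
      by_contra! h
      apply (hcon x hx k).2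
      convert hK.smul_add_mem_interior hi hM (neg_pos.2 h) using 1
      module
    refine ⟨k, ?_, ?_⟩
    -- `M < ε + m ≤ ε`; symmetrically `-m < ε` below.
    · convert hK.add_mem _ hM _ (hK.smul_mem _ (huK k) (ε - M) (by linarith)) using 1
      module
    · convert hK.add_mem _ hm _ (hK.smul_mem _ (huK k) (ε + m) (by linarith)) using 1
      rw [map_neg]
      module
  have htop : u ∈ hK.negligible hB (interior_subset hu) := by
    rw [← Submodule.span_le, hs] at hle
    exact hle trivial
  -- Any `ε < 1` would do: it puts a negative multiple of `(B ^ k) u` in `K`.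
  obtain ⟨k, hk, -⟩ := htop (1 / 2) (by norm_num)
  have := hK.nonneg_of_smul_mem (huK k)
    (hK.ne_zero_of_mem_interior (hK.pow_mem_interior hB hu k)) (a := -(1 / 2)) (by
      convert hk using 1
      module)
  norm_num at this

end Iterates
end IsProperCone

/-! ### Simple multivectors -/

theorem map_mem_grassmannCone {n j : ℕ} (A : Rn n →ₗ[ℝ] Rn n) {φ : Ext n j}
    (hφ : φ ∈ grassmannCone n j) : exteriorPower.map j A φ ∈ grassmannCone n j := by
  obtain ⟨x, rfl⟩ := hφ
  exact ⟨A ∘ x, (exteriorPower.map_apply_ιMulti A x).symm⟩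

theorem pow_map_mem_grassmannCone {n j : ℕ} (A : Rn n →ₗ[ℝ] Rn n) {φ : Ext n j}
    (hφ : φ ∈ grassmannCone n j) (k : ℕ) : (exteriorPower.map j A ^ k) φ ∈ grassmannCone n j := by
  induction k with
  | zero => simpa using hφ
  | succ k ih =>
    rw [pow_succ', Module.End.mul_apply]
    exact map_mem_grassmannCone A ih

theorem neg_mem_grassmannCone {n j : ℕ} (hj : 1 ≤ j) {φ : Ext n j}
    (hφ : φ ∈ grassmannCone n j) : -φ ∈ grassmannCone n j := by
  obtain ⟨x, rfl⟩ := hφ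
  -- Negating one factor flips the sign, which needs `j ≥ 1`.
  let i : Fin j := ⟨0, hj⟩
  refine ⟨Function.update x i (-x i), ?_⟩
  simp only [AlternatingMap.map_update_neg, Function.update_eq_self]

theorem nontrivial_ext {n j : ℕ} (hjn : j ≤ n) : Nontrivial (Ext n j) := by
  apply Module.nontrivial_of_finrank_pos (R := ℝ)
  rw [exteriorPower.finrank_eq, finrank_euclideanSpace_fin]
  exact Nat.choose_pos hjn

end GenTotPos

theorem corollary23 (n : ℕ) (S : GenTotPos.TotallyPositiveStructure n) (hS : S.IsStrict)
    (j : ℕ) (hj : 2 ≤ j) (hjn : j ≤ n) :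
    ∃ φ ∈ interior (S.cone j) ∩ GenTotPos.grassmannCone n j, φ ≠ 0 := by
  obtain ⟨A, hA⟩ := hS
  have hK := S.isProperCone j (by omega) hjn
  have := GenTotPos.nontrivial_ext hjn
  obtain ⟨x, hx, k, h | h⟩ := hK.exists_pow_mem_interior_of_span_eq_top (hA j (by omega) hjn)
    (s := GenTotPos.grassmannCone n j) (exteriorPower.ιMulti_span ℝ j (GenTotPos.Rn n))
  · exact ⟨_, ⟨h, GenTotPos.pow_map_mem_grassmannCone A hx k⟩, hK.ne_zero_of_mem_interior h⟩
  · exact ⟨_, ⟨h, GenTotPos.neg_mem_grassmannCone (by omega)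
      (GenTotPos.pow_map_mem_grassmannCone A hx k)⟩, hK.ne_zero_of_mem_interior h⟩
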